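/- Let $\mathfrak g$ be a finite-dimensional complex semisimple Lie algebra, let $\sigma$ be an antilinear involutive automorphism of $\mathfrak g$ (a conjugation), with real form $\mathfrak g^{\sigma}=\{X\in\mathfrak g\mid\sigma(X)=X\}$, and let $\mathfrak h$ be a $\sigma$-stable Cartan subalgebra of $\mathfrak g$ (equivalently, the complexification of a Cartan subalgebra of $\mathfrak g^{\sigma}$). Let $\mathcal R\subset\mathfrak h^*$ be the root system of $(\mathfrak g,\mathfrak h)$, on which $\sigma$ acts by $\sigma(\beta)(H)=\overline{\beta(\sigma(H))}$; let $\mathcal B$ be a base of simple roots of $\mathcal R$, write $\beta=\sum_{\alpha\in\mathcal B}n_{\beta,\alpha}\alpha$ with integers $n_{\beta,\alpha}$ for $\beta\in\mathcal R$, and let $\Phi\subseteq\mathcal B$. Put $$\mathcal Q_\Phi=\{\beta\in\mathcal R\mid n_{\beta,\alpha}\ge 0\ \ \forall\alpha\in\Phi\},\quad \mathcal Q_\Phi^{n}=\{\beta\in\mathcal Q_\Phi\mid-\beta\notin\mathcal Q_\Phi\},\quad \mathcal Q_\Phi^{-n}=-\mathcal Q_\Phi^{n},\quad \mathfrak q_\Phi=\mathfrak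 h\oplus\sum_{\beta\in\mathcal Q_\Phi}\mathfrak g_\beta .$$ For a complex Lie subalgebra $\mathfrak q$ of $\mathfrak g$ put $\mathfrak q^{(0)}=\mathfrak q$ and $\mathfrak q^{(k)}=\{Z\in\mathfrak q^{(k-1)}\mid[Z,\sigma(\mathfrak q)]\subseteq\mathfrak q^{(k-1)}+\sigma(\mathfrak q)\}$ for $k\ge1$. The CR algebra $(\mathfrak g^{\sigma},\mathfrak q)$ is called $k$-nondegenerate, for $k\ge 1$, if $\mathfrak q^{(k-1)}\supsetneq\mathfrak q^{(k)}=\mathfrak q\cap\sigma(\mathfrak q)$, and $0$-nondegenerate if $\mathfrak q=\mathfrak q\cap\sigma(\mathfrak q)$ (the totally real case); it is called finitely nondegenerate if it is $k$-nondegenerate for some integer $k\ge 0$. **Proposition.** The parabolic CR algebra $(\mathfrak g^{\sigma},\mathfrak q_\Phi)$ is finitely nondegenerate if and only if $$\forall\,\beta\in\mathcal Q_\Phi\cap\sigma(\mathcal Q_\Phi^{-n})\quad\exists\,\alpha\in\sigma(\mathcal Q_\Phi)\cap\mathcal Q_\Phi^{-n}\quad\text{such that}\quad\beta+\alpha\in\sigma(\mathcal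 Q_\Phi^{-n}).$$ -/

import Mathlib

open Module LieAlgebra LieAlgebra.IsKilling

noncomputable section

/-- A conjugation of a complex Lie algebra `g`: an antilinear involution `σ` of `g` which preserves
the Lie bracket. Its fixed points form a real form `g^σ` of `g`, so that `g` is the complexification
of `g^σ`, and every real form of `g` arises in this way from exactly one conjugation. -/
structure LieConjugation (g : Type*) [LieRing g] [LieAlgebra ℂ g]
    extends g →ₛₗ[starRingEnd ℂ] g where
  involutive' : ∀ x, toFun (toFun x) = x
  map_lie' : ∀ x y, toFun ⁅x, y⁆ = ⁅toFun x, toFun y⁆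

namespace LieConjugation

variable {g : Type*} [LieRing g] [LieAlgebra ℂ g] (σ : LieConjugation g)

/-- The conjugate `σ(q)` of a complex Lie subalgebra `q` of `g`. -/
def conjSubalgebra (q : LieSubalgebra ℂ g) : LieSubalgebra ℂ g where
  __ := q.toSubmodule.map σ.toLinearMap
  lie_mem' := by
    rintro _ _ ⟨x, hx, rfl⟩ ⟨y, hy, rfl⟩
    exact ⟨⁅x, y⁆, q.lie_mem hx hy, σ.map_lie' x y⟩

/-- The descending chain `q^(0) ⊇ q^(1) ⊇ ⋯` of the CR algebra `(g^σ, q)`: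
`q^(0) = q` and `q^(k+1) = {Z ∈ q^(k) | [Z, σ(q)] ⊆ q^(k) + σ(q)}`. -/
def freemanChain (q : LieSubalgebra ℂ g) : ℕ → Submodule ℂ g
  | 0 => q.toSubmodule
  | k + 1 =>
    { carrier := {Z | Z ∈ freemanChain q k ∧ ∀ W ∈ σ.conjSubalgebra q,
        ⁅Z, W⁆ ∈ freemanChain q k ⊔ (σ.conjSubalgebra q).toSubmodule}
      zero_mem' := ⟨zero_mem _, fun W _ ↦ by simp⟩
      add_mem' := fun ha hb ↦ ⟨add_mem ha.1 hb.1, fun W hW ↦ by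
        rw [add_lie]; exact add_mem (ha.2 W hW) (hb.2 W hW)⟩
      smul_mem' := fun c _ ha ↦ ⟨Submodule.smul_mem _ c ha.1, fun W hW ↦ by
        rw [smul_lie]; exact Submodule.smul_mem _ c (ha.2 W hW)⟩ }

/-- The CR algebra `(g^σ, q)` is `k`-nondegenerate: `q^(k-1) ⊋ q^(k) = q ∩ σ(q)`. For `k = 0` there
is no term `q^(k-1)`, and the condition is that `q = q ∩ σ(q)`, i.e. `(g^σ, q)` is totally real. -/
def IsKNondegenerate (q : LieSubalgebra ℂ g) : ℕ → Prop
  | 0 => σ.freemanChain q 0 = (q ⊓ σ.conjSubalgebra q).toSubmodule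
  | k + 1 => σ.freemanChain q (k + 1) < σ.freemanChain q k ∧
      σ.freemanChain q (k + 1) = (q ⊓ σ.conjSubalgebra q).toSubmodule

/-- The CR algebra `(g^σ, q)` is finitely nondegenerate: it is `k`-nondegenerate for some `k`. -/
def IsFinitelyNondegenerate (q : LieSubalgebra ℂ g) : Prop :=
  ∃ k : ℕ, σ.IsKNondegenerate q k

/-- The conjugation induced by `σ` on linear functionals on a `σ`-stable subalgebra `H`,
`σ(β)(x) = conj (β (σ x))`; on roots it is characterized by `σ(g_β) = g_{σ(β)}`. -/
def conjDual (H : LieSubalgebra ℂ g) (hH : ∀ x ∈ H, σ.toLinearMap x ∈ H) (β : Dual ℂ H) :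
    Dual ℂ H where
  toFun x := starRingEnd ℂ (β ⟨σ.toLinearMap x, hH x x.2⟩)
  map_add' x y := by
    rw [← map_add, ← map_add]
    congr 2
    exact Subtype.ext (map_add σ.toLinearMap (x : g) (y : g))
  map_smul' c x := by
    have h : (⟨σ.toLinearMap ((c • x : H) : g), hH _ (c • x).2⟩ : H) =
        starRingEnd ℂ c • ⟨σ.toLinearMap x, hH x x.2⟩ :=
      Subtype.ext (σ.toLinearMap.map_smulₛₗ c (x : g))
    rw [h, map_smul]
    simp

end LieConjugation

section Parabolic

variable {g : Type*} [LieRing g] [LieAlgebra ℂ g] [FiniteDimensional ℂ g] [IsSemisimple ℂ g]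
  {H : LieSubalgebra ℂ g} [H.IsCartanSubalgebra]

/-- The parabolic set `Q_φ` of all roots `β = ∑ n_α α` (the sum over the simple roots `α` of the
base `b`, with integral coefficients) such that `n_α ≥ 0` for all `α ∈ φ`. -/
def parabolicSet (b : (rootSystem H).Base) (φ : Set H.root) : Set (Dual ℂ H) :=
  {β | β ∈ Set.range (rootSystem H).root ∧ ∃ n : H.root → ℤ,
    β = ∑ α ∈ b.support, n α • (rootSystem H).root α ∧ ∀ α ∈ φ, 0 ≤ n α}

/-- The set `Q_φ^n = {β ∈ Q_φ | -β ∉ Q_φ}`. -/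
def parabolicSetPos (b : (rootSystem H).Base) (φ : Set H.root) : Set (Dual ℂ H) :=
  {β | β ∈ parabolicSet b φ ∧ -β ∉ parabolicSet b φ}

/-- The set `Q_φ^{-n} = -Q_φ^n`. -/
def parabolicSetNeg (b : (rootSystem H).Base) (φ : Set H.root) : Set (Dual ℂ H) :=
  {β | -β ∈ parabolicSetPos b φ}

/-- The underlying space `H ⊕ ∑ g_β`, `β ∈ Q_φ`, of the parabolic subalgebra `q_φ`. -/
def parabolicSubmodule (b : (rootSystem H).Base) (φ : Set H.root) : Submodule ℂ g :=
  H.toSubmodule ⊔ ⨆ β ∈ parabolicSet b φ, (rootSpace H (β : H → ℂ)).toSubmodule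

lemma parabolicSubmodule_eq (b : (rootSystem H).Base) (φ : Set H.root) :
    parabolicSubmodule b φ = (⨆ χ, ⨆ (_ : χ ∈ {χ : H → ℂ | ∃ n : H.root → ℤ,
      χ = ⇑(∑ α ∈ b.support, n α • (rootSystem H).root α) ∧ ∀ α ∈ φ, 0 ≤ n α}),
      rootSpace H χ).toSubmodule := by
  simp only [LieSubmodule.iSup_toSubmodule]
  apply le_antisymm
  · refine sup_le ?_ (iSup₂_le ?_)
    · refine le_trans ?_ (le_iSup₂ (0 : H → ℂ) ⟨0, by simp; rfl, by simp⟩)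
      rw [rootSpace_zero_eq]
      exact le_rfl
    · rintro β ⟨-, n, hβ, hn⟩
      exact le_iSup₂ (f := fun (χ : H → ℂ) _ ↦ (rootSpace H χ).toSubmodule) (β : H → ℂ)
        ⟨n, by rw [← hβ], hn⟩
  · refine iSup₂_le ?_
    rintro χ ⟨n, hχ, hn⟩
    by_cases h0 : χ = 0
    · rw [h0, rootSpace_zero_eq]
      exact le_sup_left
    by_cases hb : rootSpace H χ = ⊥
    · rw [hb, LieSubmodule.bot_toSubmodule]
      exact bot_le
    · refine le_trans ?_ le_sup_right
      let w : LieModule.Weight ℂ H g := ⟨χ, hb⟩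
      have hw : w ∈ H.root := Finset.mem_filter.mpr ⟨Finset.mem_univ _, h0⟩
      have h1 : ((rootSystem H).root ⟨w, hw⟩ : H → ℂ) = χ := by
        ext x; rfl
      have h2 : (rootSystem H).root ⟨w, hw⟩ ∈ parabolicSet b φ :=
        ⟨⟨_, rfl⟩, n, DFunLike.coe_injective (h1.trans hχ), hn⟩
      have h3 := le_iSup₂ (f := fun (β : Dual ℂ H) (_ : β ∈ parabolicSet b φ) ↦
        (rootSpace H (β : H → ℂ)).toSubmodule) _ h2
      rwa [h1] at h3

/-- The parabolic subalgebra `q_φ = H ⊕ ∑ g_β`, `β ∈ Q_φ`. -/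
def parabolicSubalgebra (b : (rootSystem H).Base) (φ : Set H.root) : LieSubalgebra ℂ g where
  __ := parabolicSubmodule b φ
  lie_mem' := by
    intro x y hx hy
    change x ∈ parabolicSubmodule b φ at hx
    change y ∈ parabolicSubmodule b φ at hy
    change ⁅x, y⁆ ∈ parabolicSubmodule b φ
    rw [parabolicSubmodule_eq, LieSubmodule.mem_toSubmodule] at hx hy ⊢
    refine mem_biSup_genWeightSpace_of ?_ hx hy
    rintro _ ⟨n, rfl, hn⟩ _ ⟨m, rfl, hm⟩
    refine ⟨n + m, ?_, fun α hα ↦ add_nonneg (hn α hα) (hm α hα)⟩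
    have h : ∑ α ∈ b.support, (n + m) α • (rootSystem H).root α =
        ∑ α ∈ b.support, n α • (rootSystem H).root α +
          ∑ α ∈ b.support, m α • (rootSystem H).root α := by
      rw [← Finset.sum_add_distrib]
      simp only [Pi.add_apply, add_smul]
    rw [h]
    rfl

end Parabolic

end

/-! Write `P` for `Q_Φ` and `P'` for `σ(Q_Φ)`; their complements in the roots are `Q_Φ^{-n}` and
`σ(Q_Φ^{-n})`. Every `q^(k)` is `H`-stable (`lie_mem_freemanChain`), hence a sum of its weight
parts, and brackets of nonzero root vectors do not vanish when the sum is a root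
(`lie_ne_zero_of_add_mem_rootSet`). So the problem is one about roots.

If the condition holds and the stationary term of the chain had weights outside `P' ∪ {0}`, take one
of least height, the height being negative on `Q_Φ^{-n}`. Adding the `α` of the condition yields
another such weight, of smaller height: a contradiction.

If the condition fails at `β`, consider the roots reached from `β` by adding elements of `P ∩ P'`
without entering `P'`. By `reflTransGen_rootStep_add`, adding any element of `P'` gives a reachable
root, an element of `P' ∪ {0}`, or a non-weight. Hence their root spaces lie in every `q^(k)`, while
`g_β` is not in `σ(q)`. -/

set_option linter.unusedSectionVars false

/-! ### Brackets of root vectors and sums of weight spaces. -/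

section RootSpaces

variable {g : Type*} [LieRing g] [LieAlgebra ℂ g] [FiniteDimensional ℂ g] [IsSemisimple ℂ g]
  {H : LieSubalgebra ℂ g} [H.IsCartanSubalgebra]

/-- If `α`, `β` and `α + β` are weights with `α`, `β` nonzero, then brackets of nonzero vectors of
the root spaces of `α` and `β` are nonzero. -/
lemma lie_ne_zero_of_mem_rootSpace {α β : LieModule.Weight ℂ H g} (hα : α.IsNonZero)
    (hβ : β.IsNonZero) (hαβ : rootSpace H (α + β : H → ℂ) ≠ ⊥) {x y : g}
    (hx : x ∈ rootSpace H α) (hx0 : x ≠ 0) (hy : y ∈ rootSpace H β) (hy0 : y ≠ 0) :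
    ⁅x, y⁆ ≠ 0 := by
  obtain ⟨v, hv, v_ne0⟩ := (LieModule.chainTop α β).exists_ne_zero
  obtain ⟨h, e, f, isSl2, he, hf⟩ := exists_isSl2Triple_of_weight_isNonZero hα
  obtain rfl := isSl2.h_eq_coroot hα he hf
  have prim : isSl2.HasPrimitiveVectorWith v (chainLength α β : ℂ) :=
    have := LieAlgebra.lie_mem_genWeightSpace_of_mem_genWeightSpace he hv
    ⟨v_ne0, (chainLength_smul _ _ hv).symm,
      by rwa [LieModule.genWeightSpace_add_chainTop _ _ hα] at this⟩
  have htop : 1 ≤ LieModule.chainTopCoeff α β := by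
    have := ((rootSpace_zsmul_add_ne_bot_iff α β hα 1).mp (by simpa using hαβ)).1
    exact_mod_cast this
  obtain ⟨q, hq⟩ := Nat.exists_eq_add_of_le' htop
  have hle := chainTopCoeff_le_chainLength α β
  have hw := toEnd_pow_apply_mem hf hv (q + 1)
  have hw0 := prim.pow_toEnd_f_ne_zero_of_eq_nat rfl (hq ▸ hle)
  have hu0 := prim.pow_toEnd_f_ne_zero_of_eq_nat rfl (i := q) (by omega)
  -- With `v` at the top of the `α`-chain of length `n`, `[e, f^(q+1) v] = (q+1)(n-q) f^q v`. Here
  -- `q + 1` is the number of steps from `β` to the top, so `y` is proportional to `f^(q+1) v`, and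
  -- `q < n`.
  have hew := prim.lie_e_pow_succ_toEnd_f q
  set w := ((LieModule.toEnd ℂ g g f) ^ (q + 1)) v
  set u := ((LieModule.toEnd ℂ g g f) ^ q) v
  have hwt : (q + 1) • (-α : H → ℂ) + LieModule.chainTop α β = β := by
    rw [LieModule.coe_chainTop', hq]
    module
  rw [hwt] at hw
  obtain ⟨c, hc⟩ : ∃ c : ℂ, c • y = w := by
    simpa using (finrank_eq_one_iff_of_nonzero' ⟨y, hy⟩ (by simpa using hy0)).mp
      (finrank_rootSpace_eq_one _ hβ) ⟨w, hw⟩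
  obtain ⟨d, hd⟩ : ∃ d : ℂ, d • x = e := by
    simpa using (finrank_eq_one_iff_of_nonzero' ⟨x, hx⟩ (by simpa using hx0)).mp
      (finrank_rootSpace_eq_one _ hα) ⟨e, he⟩
  intro h0
  rw [← hc, ← hd, smul_lie, lie_smul, h0, smul_zero, smul_zero, eq_comm, smul_eq_zero] at hew
  refine hew.elim (mul_ne_zero (by exact_mod_cast q.succ_ne_zero) ?_) hu0
  rw [sub_ne_zero]
  exact_mod_cast (by omega : chainLength α β ≠ q)

/-- The set of roots, as linear functionals. -/
abbrev rootSet (H : LieSubalgebra ℂ g) [H.IsCartanSubalgebra] : Set (Dual ℂ H) :=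
  Set.range (rootSystem H).root

lemma mem_rootSet_iff {χ : Dual ℂ H} :
    χ ∈ rootSet H ↔ χ ≠ 0 ∧ rootSpace H (χ : H → ℂ) ≠ ⊥ := by
  constructor
  · rintro ⟨w, rfl⟩
    refine ⟨(rootSystem H).ne_zero w, ?_⟩
    exact w.1.genWeightSpace_ne_bot
  · rintro ⟨h0, hb⟩
    have h0' : (⟨χ, hb⟩ : LieModule.Weight ℂ H g).IsNonZero := fun h ↦
      h0 (DFunLike.coe_injective h)
    refine ⟨⟨⟨χ, hb⟩, Finset.mem_filter.mpr ⟨Finset.mem_univ _, h0'⟩⟩, ?_⟩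
    ext x
    rfl

lemma neg_mem_rootSet {χ : Dual ℂ H} (h : χ ∈ rootSet H) : -χ ∈ rootSet H := by
  obtain ⟨w, rfl⟩ := h
  exact (rootSystem H).neg_root_mem w

lemma exists_ne_zero_of_mem_rootSet {χ : Dual ℂ H} (h : χ ∈ rootSet H) :
    ∃ x ∈ rootSpace H (χ : H → ℂ), x ≠ 0 :=
  by
  by_contra! hcon
  exact (mem_rootSet_iff.mp h).2 ((LieSubmodule.eq_bot_iff _).mpr hcon)

lemma lie_mem_rootSpace_add {χ ψ : Dual ℂ H} {x y : g} (hx : x ∈ rootSpace H (χ : H → ℂ))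
    (hy : y ∈ rootSpace H (ψ : H → ℂ)) : ⁅x, y⁆ ∈ rootSpace H ((χ + ψ : Dual ℂ H) : H → ℂ) :=
  LieAlgebra.lie_mem_genWeightSpace_of_mem_genWeightSpace hx hy

lemma lie_ne_zero_of_add_mem_rootSet {χ ψ : Dual ℂ H} (hχ : χ ∈ rootSet H) (hψ : ψ ∈ rootSet H)
    (h : χ + ψ ∈ rootSet H) {x y : g} (hx : x ∈ rootSpace H (χ : H → ℂ)) (hx0 : x ≠ 0)
    (hy : y ∈ rootSpace H (ψ : H → ℂ)) (hy0 : y ≠ 0) : ⁅x, y⁆ ≠ 0 := by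
  obtain ⟨hχ0, hχ⟩ := mem_rootSet_iff.mp hχ
  obtain ⟨hψ0, hψ⟩ := mem_rootSet_iff.mp hψ
  exact lie_ne_zero_of_mem_rootSpace (α := ⟨χ, hχ⟩) (β := ⟨ψ, hψ⟩)
    (fun h ↦ hχ0 (DFunLike.coe_injective h)) (fun h ↦ hψ0 (DFunLike.coe_injective h))
    (mem_rootSet_iff.mp h).2 hx hx0 hy hy0

/-- If three roots `a`, `b`, `c` are such that `a + b` and `a + b + c` are roots, then `b + c` or
`a + c` is a root or zero. -/
lemma add_mem_insert_rootSet_or {a b c : Dual ℂ H} (ha : a ∈ rootSet H) (hb : b ∈ rootSet H)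
    (hc : c ∈ rootSet H) (hab : a + b ∈ rootSet H) (habc : a + b + c ∈ rootSet H) :
    b + c ∈ insert 0 (rootSet H) ∨ a + c ∈ insert 0 (rootSet H) := by
  obtain ⟨x, hx, hx0⟩ := exists_ne_zero_of_mem_rootSet ha
  obtain ⟨y, hy, hy0⟩ := exists_ne_zero_of_mem_rootSet hb
  obtain ⟨z, hz, hz0⟩ := exists_ne_zero_of_mem_rootSet hc
  have h := lie_ne_zero_of_add_mem_rootSet hab hc habc (lie_mem_rootSpace_add hx hy)
    (lie_ne_zero_of_add_mem_rootSet ha hb hab hx hx0 hy hy0) hz hz0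
  have key : ∀ {χ : Dual ℂ H} {v : g}, χ ∉ insert 0 (rootSet H) →
      v ∈ rootSpace H (χ : H → ℂ) → v = 0 := by
    intro χ v hχ hv
    rw [Set.mem_insert_iff, mem_rootSet_iff] at hχ
    push Not at hχ
    rwa [hχ.2 hχ.1, LieSubmodule.mem_bot] at hv
  by_contra! hcon
  -- Jacobi: `[[x,y],z] = [x,[y,z]] - [y,[x,z]]`, and both inner brackets lie in zero spaces.
  rw [lie_lie, key hcon.1 (lie_mem_rootSpace_add hy hz), key hcon.2 (lie_mem_rootSpace_add hx hz),
    lie_zero, lie_zero, sub_zero] at h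
  exact h rfl

/-- The sum of the (generalized) weight spaces of the functionals in `S`. -/
noncomputable def weightSum (S : Set (Dual ℂ H)) : Submodule ℂ g :=
  ⨆ χ ∈ S, (rootSpace H (χ : H → ℂ)).toSubmodule

lemma rootSpace_le_weightSum {S : Set (Dual ℂ H)} {χ : Dual ℂ H} (h : χ ∈ S) :
    (rootSpace H (χ : H → ℂ)).toSubmodule ≤ weightSum S :=
  le_iSup₂ (f := fun (χ : Dual ℂ H) (_ : χ ∈ S) ↦ (rootSpace H (χ : H → ℂ)).toSubmodule) χ h

lemma weightSum_mono {S T : Set (Dual ℂ H)} (h : S ⊆ T) : weightSum S ≤ weightSum T :=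
  biSup_mono h

lemma mem_of_mem_weightSum {S : Set (Dual ℂ H)} {χ : Dual ℂ H} {x : g}
    (hx : x ∈ rootSpace H (χ : H → ℂ)) (hx0 : x ≠ 0) (h : x ∈ weightSum S) : χ ∈ S := by
  by_contra hχ
  have hind : iSupIndep fun χ : Dual ℂ H ↦ (rootSpace H (χ : H → ℂ)).toSubmodule :=
    (LieSubmodule.iSupIndep_toSubmodule.mpr (LieModule.iSupIndep_genWeightSpace ℂ H g)).comp
      DFunLike.coe_injective
  have hd : Disjoint (rootSpace H (χ : H → ℂ)).toSubmodule (weightSum S) := by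
    refine (hind χ).mono_right (biSup_mono fun ψ hψ ↦ ?_)
    rintro rfl
    exact hχ hψ
  exact hx0 (Submodule.disjoint_def.mp hd x hx h)

lemma le_weightSum_of_lie_mem (N : Submodule ℂ g) (hN : ∀ h ∈ H, ∀ x ∈ N, ⁅h, x⁆ ∈ N) :
    N ≤ weightSum {χ : Dual ℂ H | ∃ x ∈ N, x ∈ rootSpace H (χ : H → ℂ) ∧ x ≠ 0} := by
  let N' : LieSubmodule ℂ H g := { N with lie_mem := fun {h x} hx ↦ hN h h.2 x hx }
  have h1 : N = (⨆ χ : LieModule.Weight ℂ H g, N' ⊓ LieModule.genWeightSpace g χ).toSubmodule :=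
    congrArg LieSubmodule.toSubmodule (LieModule.eq_iSup_inf_genWeightSpace ℂ H g N')
  refine h1.le.trans ?_
  rw [LieSubmodule.iSup_toSubmodule]
  refine iSup_le fun χ x hx ↦ ?_
  by_cases hx0 : x = 0
  · rw [hx0]
    exact zero_mem _
  · exact rootSpace_le_weightSum (χ := LieModule.Weight.toLinear ℂ H g χ)
      (S := {χ : Dual ℂ H | ∃ x ∈ N, x ∈ rootSpace H (χ : H → ℂ) ∧ x ≠ 0})
      ⟨x, hx.1, hx.2, hx0⟩ hx.2

lemma toSubmodule_eq_rootSpace_zero :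
    H.toSubmodule = (rootSpace H ((0 : Dual ℂ H) : H → ℂ)).toSubmodule := by
  have h : ((0 : Dual ℂ H) : H → ℂ) = 0 := rfl
  rw [h, rootSpace_zero_eq]
  rfl

lemma sup_weightSum (S : Set (Dual ℂ H)) :
    H.toSubmodule ⊔ ⨆ χ ∈ S, (rootSpace H (χ : H → ℂ)).toSubmodule = weightSum (insert 0 S) := by
  rw [weightSum, iSup_insert, toSubmodule_eq_rootSpace_zero]

end RootSpaces

/-! ### Closure, complement and grading of the parabolic set. -/

section ParabolicSet

variable {g : Type*} [LieRing g] [LieAlgebra ℂ g] [FiniteDimensional ℂ g] [IsSemisimple ℂ g]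
  {H : LieSubalgebra ℂ g} [H.IsCartanSubalgebra] (b : (rootSystem H).Base) (φ : Set H.root)

lemma toSubmodule_parabolicSubalgebra :
    (parabolicSubalgebra b φ).toSubmodule = weightSum (insert 0 (parabolicSet b φ)) :=
  sup_weightSum _

variable {b φ}

lemma add_mem_parabolicSet {x y : Dual ℂ H} (hx : x ∈ parabolicSet b φ)
    (hy : y ∈ parabolicSet b φ) (h : x + y ∈ rootSet H) : x + y ∈ parabolicSet b φ := by
  obtain ⟨-, n, rfl, hn⟩ := hx
  obtain ⟨-, m, rfl, hm⟩ := hy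
  refine ⟨h, n + m, ?_, fun α hα ↦ add_nonneg (hn α hα) (hm α hα)⟩
  simp only [Pi.add_apply, add_smul, Finset.sum_add_distrib]

lemma mem_parabolicSet_or_neg_mem {x : Dual ℂ H} (hx : x ∈ rootSet H) :
    x ∈ parabolicSet b φ ∨ -x ∈ parabolicSet b φ := by
  obtain ⟨i, rfl⟩ := hx
  obtain ⟨f, -, hf, hi⟩ := b.exists_root_eq_sum_int i
  refine hf.imp (fun h ↦ ⟨⟨i, rfl⟩, f, hi, fun α _ ↦ h.le α⟩)
    (fun h ↦ ⟨neg_mem_rootSet ⟨i, rfl⟩, -f, ?_, fun α _ ↦ ?_⟩)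
  · rw [hi]
    simp only [Pi.neg_apply, neg_smul, Finset.sum_neg_distrib]
  · simpa using h.le α

lemma mem_parabolicSetNeg_iff {x : Dual ℂ H} :
    x ∈ parabolicSetNeg b φ ↔ x ∈ rootSet H ∧ x ∉ parabolicSet b φ := by
  simp only [parabolicSetNeg, parabolicSetPos, Set.mem_ofPred_eq, neg_neg]
  refine ⟨fun h ↦ ⟨by simpa using neg_mem_rootSet h.1.1, h.2⟩, fun h ↦ ⟨?_, h.2⟩⟩
  exact (mem_parabolicSet_or_neg_mem h.1).resolve_left h.2

/-- There is an additive function which is negative on `Q_φ^{-n}`. -/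
lemma exists_addMonoidHom_neg (b : (rootSystem H).Base) (φ : Set H.root) (hφ : φ ⊆ b.support) :
    ∃ ht : Dual ℂ H →+ ℝ, ∀ x ∈ parabolicSetNeg b φ, ht x < 0 := by
  classical
  -- The sum of the coefficients at the simple roots in `φ`; its real part serves as an ordered
  -- height.
  let ℓ : Dual ℂ H →ₗ[ℂ] ℂ :=
    b.toWeightBasis.constr ℂ (fun i ↦ if (i : H.root) ∈ φ then (1 : ℂ) else 0)
  have hℓ : ∀ i ∈ b.support, ℓ ((rootSystem H).root i) = if i ∈ φ then 1 else 0 := by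
    intro i hi
    have := b.toWeightBasis.constr_basis ℂ (fun i ↦ if (i : H.root) ∈ φ then (1 : ℂ) else 0) ⟨i, hi⟩
    rwa [b.toWeightBasis_apply] at this
  refine ⟨Complex.reAddGroupHom.comp ℓ.toAddMonoidHom, fun x hx ↦ ?_⟩
  obtain ⟨⟨hxR, n, hn, hn0⟩, -⟩ : -x ∈ parabolicSetPos b φ := id hx
  rw [mem_parabolicSetNeg_iff] at hx
  -- Otherwise all coefficients of `-x` on `φ` would be nonpositive, putting `x` itself in `Q_φ`.
  obtain ⟨i, hi, hni⟩ : ∃ i ∈ φ, 0 < n i := by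
    by_contra! hcon
    refine hx.2 ⟨hx.1, -n, ?_, fun α hα ↦ by simpa using hcon α hα⟩
    rw [← neg_neg x, hn]
    simp only [Pi.neg_apply, neg_smul, Finset.sum_neg_distrib]
  have hval : (ℓ (-x)).re = ∑ j ∈ b.support, if j ∈ φ then (n j : ℝ) else 0 := by
    rw [hn, map_sum, Complex.re_sum]
    refine Finset.sum_congr rfl fun j hj ↦ ?_
    rw [map_zsmul, hℓ j hj]
    split_ifs <;> simp
  have hpos : 0 < (ℓ (-x)).re := by
    rw [hval]
    refine Finset.sum_pos' (fun j _ ↦ ?_) ⟨i, hφ hi, by simpa [hi] using hni⟩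
    split_ifs with h
    · exact_mod_cast hn0 j h
    · exact le_rfl
  simpa using hpos

end ParabolicSet

namespace LieConjugation

variable {g : Type*} [LieRing g] [LieAlgebra ℂ g] (σ : LieConjugation g)

/-! ### The descending chain of a general subalgebra. -/

section Chain

variable (q : LieSubalgebra ℂ g)

lemma freemanChain_succ_le (k : ℕ) : σ.freemanChain q (k + 1) ≤ σ.freemanChain q k :=
  fun _ h ↦ h.1

lemma inf_conjSubalgebra_le_freemanChain (k : ℕ) :
    (q ⊓ σ.conjSubalgebra q).toSubmodule ≤ σ.freemanChain q k := by
  induction k with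
  | zero => exact fun x hx ↦ hx.1
  | succ k ih =>
    exact fun x hx ↦ ⟨ih hx, fun W hW ↦
      Submodule.mem_sup_right ((σ.conjSubalgebra q).lie_mem hx.2 hW)⟩

/-- Jacobi and induction on `k`. Applied to `h ∈ H ⊆ q ∩ σ(q)`, it gives the weight decomposition of
the chain. -/
lemma lie_mem_freemanChain (k : ℕ) {h : g} (hq : h ∈ q) (hσ : h ∈ σ.conjSubalgebra q) {x : g}
    (hx : x ∈ σ.freemanChain q k) : ⁅h, x⁆ ∈ σ.freemanChain q k := by
  induction k generalizing x with
  | zero => exact q.lie_mem hq hx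
  | succ k ih =>
    refine ⟨ih hx.1, fun W hW ↦ ?_⟩
    rw [lie_lie]
    refine sub_mem ?_ (hx.2 _ ((σ.conjSubalgebra q).lie_mem hσ hW))
    obtain ⟨u, hu, v, hv, huv⟩ := Submodule.mem_sup.mp (hx.2 W hW)
    rw [← huv, lie_add]
    exact add_mem (Submodule.mem_sup_left (ih hu))
      (Submodule.mem_sup_right ((σ.conjSubalgebra q).lie_mem hσ hv))

/-- The strict inclusion in the definition is automatic at the least index where the chain equals `q
∩ σ(q)`. -/
lemma isFinitelyNondegenerate_iff_exists :
    σ.IsFinitelyNondegenerate q ↔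
      ∃ k, σ.freemanChain q k = (q ⊓ σ.conjSubalgebra q).toSubmodule := by
  classical
  constructor
  · rintro ⟨_ | k, hk⟩
    exacts [⟨0, hk⟩, ⟨k + 1, hk.2⟩]
  · intro h
    obtain ⟨k, hk, hmin⟩ : ∃ k, σ.freemanChain q k = (q ⊓ σ.conjSubalgebra q).toSubmodule ∧
        ∀ m < k, σ.freemanChain q m ≠ (q ⊓ σ.conjSubalgebra q).toSubmodule :=
      ⟨Nat.find h, Nat.find_spec h, fun m hm ↦ Nat.find_min h hm⟩
    cases k with
    | zero => exact ⟨0, hk⟩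
    | succ k =>
      refine ⟨k + 1, lt_of_le_of_ne (σ.freemanChain_succ_le q k) fun he ↦ ?_, hk⟩
      exact hmin k k.lt_succ_self (he ▸ hk)

lemma exists_freemanChain_succ_eq [FiniteDimensional ℂ g] :
    ∃ k, σ.freemanChain q (k + 1) = σ.freemanChain q k := by
  obtain ⟨k, hk⟩ := IsArtinian.monotone_stabilizes (R := ℂ) (M := g)
    ⟨fun k ↦ OrderDual.toDual (σ.freemanChain q k),
      monotone_nat_of_le_succ fun k ↦ σ.freemanChain_succ_le q k⟩
  exact ⟨k, (hk (k + 1) k.le_succ).symm⟩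

end Chain

/-! ### The conjugation acting on weights. -/

variable [FiniteDimensional ℂ g] [IsSemisimple ℂ g]
  {H : LieSubalgebra ℂ g} (hH : ∀ x ∈ H, σ.toLinearMap x ∈ H)

lemma apply_apply (x : g) : σ.toLinearMap (σ.toLinearMap x) = x := σ.involutive' x

lemma conjDual_add (χ ψ : Dual ℂ H) :
    σ.conjDual H hH (χ + ψ) = σ.conjDual H hH χ + σ.conjDual H hH ψ := by
  ext x
  simp [conjDual]

lemma conjDual_zero : σ.conjDual H hH 0 = 0 := by
  ext x
  simp [conjDual]

lemma conjDual_conjDual (χ : Dual ℂ H) : σ.conjDual H hH (σ.conjDual H hH χ) = χ := by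
  ext x
  simp [conjDual, apply_apply]

lemma mem_image_conjDual_iff {S : Set (Dual ℂ H)} {χ : Dual ℂ H} :
    χ ∈ σ.conjDual H hH '' S ↔ σ.conjDual H hH χ ∈ S := by
  constructor
  · rintro ⟨ψ, hψ, rfl⟩
    rwa [conjDual_conjDual]
  · exact fun h ↦ ⟨_, h, σ.conjDual_conjDual hH χ⟩

variable [H.IsCartanSubalgebra]

lemma apply_mem_rootSpace_conjDual {χ : Dual ℂ H} {x : g} (hx : x ∈ rootSpace H (χ : H → ℂ)) :
    σ.toLinearMap x ∈ rootSpace H (σ.conjDual H hH χ : H → ℂ) := by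
  refine LieModule.weightSpace_le_genWeightSpace g _ ((LieModule.mem_weightSpace _ _).mpr ?_)
  intro h
  have h1 : ⁅σ.toLinearMap h, x⁆ = χ ⟨σ.toLinearMap h, hH h h.2⟩ • x :=
    lie_eq_smul_of_mem_rootSpace hx ⟨σ.toLinearMap h, hH h h.2⟩
  have h2 : ⁅(h : g), σ.toLinearMap x⁆ = σ.toLinearMap ⁅σ.toLinearMap h, x⁆ := by
    have h3 : σ.toLinearMap ⁅σ.toLinearMap (h : g), x⁆ =
        ⁅σ.toLinearMap (σ.toLinearMap (h : g)), σ.toLinearMap x⁆ := σ.map_lie' _ _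
    rw [h3, σ.apply_apply]
  rw [h1, map_smulₛₗ] at h2
  exact h2

lemma conjDual_mem_rootSet {χ : Dual ℂ H} (h : χ ∈ rootSet H) :
    σ.conjDual H hH χ ∈ rootSet H := by
  obtain ⟨x, hx, hx0⟩ := exists_ne_zero_of_mem_rootSet h
  rw [mem_rootSet_iff] at h ⊢
  refine ⟨fun h0 ↦ h.1 ?_, fun hb ↦ hx0 ?_⟩
  · rw [← σ.conjDual_conjDual hH χ, h0, conjDual_zero]
  · have := σ.apply_mem_rootSpace_conjDual hH hx
    rw [hb, LieSubmodule.mem_bot] at this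
    rw [← σ.apply_apply x, this, map_zero]

lemma map_weightSum (S : Set (Dual ℂ H)) :
    (weightSum S).map σ.toLinearMap = weightSum (σ.conjDual H hH '' S) := by
  apply le_antisymm
  · simp only [weightSum, Submodule.map_iSup]
    refine iSup₂_le fun χ hχ ↦ ?_
    rintro _ ⟨x, hx, rfl⟩
    exact rootSpace_le_weightSum (Set.mem_image_of_mem _ hχ)
      (σ.apply_mem_rootSpace_conjDual hH hx)
  · refine iSup₂_le ?_
    rintro _ ⟨χ, hχ, rfl⟩ x hx
    refine ⟨σ.toLinearMap x, rootSpace_le_weightSum hχ ?_, σ.apply_apply x⟩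
    have h := σ.apply_mem_rootSpace_conjDual hH hx
    rwa [conjDual_conjDual] at h

variable (b : (rootSystem H).Base) (φ : Set H.root)

lemma toSubmodule_conjSubalgebra_parabolicSubalgebra :
    (σ.conjSubalgebra (parabolicSubalgebra b φ)).toSubmodule =
      weightSum (insert 0 (σ.conjDual H hH '' parabolicSet b φ)) := by
  have h : (σ.conjSubalgebra (parabolicSubalgebra b φ)).toSubmodule =
    (parabolicSubalgebra b φ).toSubmodule.map σ.toLinearMap := rfl
  rw [h, toSubmodule_parabolicSubalgebra, map_weightSum σ hH, Set.image_insert_eq, conjDual_zero]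

variable {b φ}

lemma add_mem_image_parabolicSet {x y : Dual ℂ H}
    (hx : x ∈ σ.conjDual H hH '' parabolicSet b φ) (hy : y ∈ σ.conjDual H hH '' parabolicSet b φ)
    (h : x + y ∈ rootSet H) : x + y ∈ σ.conjDual H hH '' parabolicSet b φ := by
  rw [mem_image_conjDual_iff] at hx hy ⊢
  rw [conjDual_add]
  exact add_mem_parabolicSet hx hy (σ.conjDual_add hH x y ▸ σ.conjDual_mem_rootSet hH h)

lemma mem_image_parabolicSetNeg_iff {x : Dual ℂ H} :
    x ∈ σ.conjDual H hH '' parabolicSetNeg b φ ↔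
      x ∈ rootSet H ∧ x ∉ σ.conjDual H hH '' parabolicSet b φ := by
  rw [mem_image_conjDual_iff, mem_image_conjDual_iff, mem_parabolicSetNeg_iff]
  refine and_congr_left fun _ ↦ ⟨fun h ↦ ?_, σ.conjDual_mem_rootSet hH⟩
  simpa only [conjDual_conjDual] using σ.conjDual_mem_rootSet hH h

end LieConjugation

/-! ### Roots reachable through `P ∩ P'`. -/

section Reachable

variable {g : Type*} [LieRing g] [LieAlgebra ℂ g] [FiniteDimensional ℂ g] [IsSemisimple ℂ g]
  {H : LieSubalgebra ℂ g} [H.IsCartanSubalgebra]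

/-- `γ'` is a root outside of `P'` which is obtained from `γ` by adding an element of `P ∩ P'`. -/
def RootStep (P P' : Set (Dual ℂ H)) (γ γ' : Dual ℂ H) : Prop :=
  γ' ∈ rootSet H \ P' ∧ ∃ α ∈ P ∩ P', γ' = γ + α

variable {P P' : Set (Dual ℂ H)} {β : Dual ℂ H}

lemma mem_of_reflTransGen_rootStep
    (hP : ∀ x ∈ P, ∀ y ∈ P, x + y ∈ rootSet H → x + y ∈ P)
    (hβ : β ∈ P \ P') {γ : Dual ℂ H} (hγ : Relation.ReflTransGen (RootStep P P') β γ) :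
    γ ∈ P \ P' := by
  induction hγ with
  | refl => exact hβ
  | tail _ hs ih =>
    obtain ⟨h, α, hα, rfl⟩ := hs
    exact ⟨hP _ ih.1 _ hα.1 h.1, h.2⟩

/-- If no sum of `β` and an element of `P' \ P` is a root outside of `P'`, then the set of the roots
reachable from `β` is stable, up to `P'`, under addition of all the elements of `P'`. -/
lemma reflTransGen_rootStep_add
    (hP : ∀ x ∈ P, ∀ y ∈ P, x + y ∈ rootSet H → x + y ∈ P) (hPR : P ⊆ rootSet H)
    (hP' : ∀ x ∈ P', ∀ y ∈ P', x + y ∈ rootSet H → x + y ∈ P') (hPR' : P' ⊆ rootSet H)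
    (hβ : β ∈ P \ P') (hext : ∀ α ∈ P' \ P, β + α ∉ rootSet H \ P')
    {γ : Dual ℂ H} (hγ : Relation.ReflTransGen (RootStep P P') β γ)
    {α : Dual ℂ H} (hα : α ∈ P') (hγα : γ + α ∈ rootSet H \ P') :
    Relation.ReflTransGen (RootStep P P') β (γ + α) := by
  induction hγ generalizing α with
  | refl =>
    by_cases hαP : α ∈ P
    · exact .tail .refl ⟨hγα, α, ⟨hαP, hα⟩, rfl⟩
    · exact absurd hγα (hext α ⟨hα, hαP⟩)
  | @tail γ' _ hγ' hs ih =>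
    obtain ⟨hs, δ, hδ, rfl⟩ := hs
    have hγ'R : γ' ∈ rootSet H := hPR (mem_of_reflTransGen_rootStep hP hβ hγ').1
    have hcomm : γ' + α + δ = γ' + δ + α := by abel
    -- Either `δ` and `α` merge into one element of `P'` (or cancel), and induction applies at `γ'`;
    -- or `α` is added before `δ`, where closure of `P'` keeps `γ' + α` outside `P'`.
    rcases add_mem_insert_rootSet_or hγ'R (hPR' hδ.2) (hPR' hα) hs.1 hγα.1 with
      (h | h) | (h | h)
    · rwa [add_assoc, h, add_zero]
    · rw [add_assoc] at hγα ⊢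
      exact ih (hP' _ hδ.2 _ hα h) hγα
    · rw [← hcomm, h, zero_add] at hγα
      exact absurd hδ.2 hγα.2
    · have hn : γ' + α ∉ P' := fun hmem ↦
        hγα.2 (hcomm ▸ hP' _ hmem _ hδ.2 (hcomm ▸ hγα.1))
      exact .tail (ih hα ⟨h, hn⟩) ⟨hγα, δ, hδ, hcomm.symm⟩

end Reachable

/-! ### The criterion. -/

theorem mainTheorem8 {g : Type*} [LieRing g] [LieAlgebra ℂ g] [FiniteDimensional ℂ g]
    [LieAlgebra.IsSemisimple ℂ g] (σ : LieConjugation g)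
    (H : LieSubalgebra ℂ g) [H.IsCartanSubalgebra] (hH : ∀ x ∈ H, σ.toLinearMap x ∈ H)
    (b : (LieAlgebra.IsKilling.rootSystem H).Base) (φ : Set H.root) (hφ : φ ⊆ b.support) :
    σ.IsFinitelyNondegenerate (parabolicSubalgebra b φ) ↔
      ∀ β ∈ parabolicSet b φ ∩ σ.conjDual H hH '' parabolicSetNeg b φ,
        ∃ α ∈ σ.conjDual H hH '' parabolicSet b φ ∩ parabolicSetNeg b φ,
          β + α ∈ σ.conjDual H hH '' parabolicSetNeg b φ := by
  rw [LieConjugation.isFinitelyNondegenerate_iff_exists]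
  have hq := toSubmodule_parabolicSubalgebra b φ
  have hσq := σ.toSubmodule_conjSubalgebra_parabolicSubalgebra hH b φ
  have hPR : parabolicSet b φ ⊆ rootSet H := fun _ h ↦ h.1
  have hPR' : σ.conjDual H hH '' parabolicSet b φ ⊆ rootSet H := by
    rintro _ ⟨χ, hχ, rfl⟩
    exact σ.conjDual_mem_rootSet hH (hPR hχ)
  have hHq : H.toSubmodule ≤ (parabolicSubalgebra b φ).toSubmodule := by
    rw [hq, toSubmodule_eq_rootSpace_zero]
    exact rootSpace_le_weightSum (Set.mem_insert _ _)
  have hHσq : H.toSubmodule ≤ (σ.conjSubalgebra (parabolicSubalgebra b φ)).toSubmodule := by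
    rw [hσq, toSubmodule_eq_rootSpace_zero]
    exact rootSpace_le_weightSum (Set.mem_insert _ _)
  set q := parabolicSubalgebra b φ
  constructor
  · rintro ⟨k, hk⟩ β ⟨hβ, hβ'⟩
    rw [σ.mem_image_parabolicSetNeg_iff] at hβ'
    by_contra! hcon
    have hext : ∀ α ∈ σ.conjDual H hH '' parabolicSet b φ \ parabolicSet b φ,
        β + α ∉ rootSet H \ σ.conjDual H hH '' parabolicSet b φ := fun α hα h ↦
      hcon α ⟨hα.1, mem_parabolicSetNeg_iff.mpr ⟨hPR' hα.1, hα.2⟩⟩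
        ((σ.mem_image_parabolicSetNeg_iff hH).mpr h)
    have hP : ∀ x ∈ parabolicSet b φ, ∀ y ∈ parabolicSet b φ, x + y ∈ rootSet H →
      x + y ∈ parabolicSet b φ := fun _ hx _ hy h ↦ add_mem_parabolicSet hx hy h
    have hP' : ∀ x ∈ σ.conjDual H hH '' parabolicSet b φ,
      ∀ y ∈ σ.conjDual H hH '' parabolicSet b φ, x + y ∈ rootSet H →
      x + y ∈ σ.conjDual H hH '' parabolicSet b φ := fun _ hx _ hy h ↦
        σ.add_mem_image_parabolicSet hH hx hy h
    -- The claim for `β` alone would not survive the induction on `n`: all reachable roots are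
    -- carried together.
    have hmem : ∀ n γ, Relation.ReflTransGen
        (RootStep (parabolicSet b φ) (σ.conjDual H hH '' parabolicSet b φ)) β γ →
        (rootSpace H (γ : H → ℂ)).toSubmodule ≤ σ.freemanChain q n := by
      intro n
      induction n with
      | zero =>
        intro γ hγ
        refine (rootSpace_le_weightSum (Set.mem_insert_of_mem _ ?_)).trans hq.ge
        exact (mem_of_reflTransGen_rootStep hP ⟨hβ, hβ'.2⟩ hγ).1
      | succ n ih =>
        intro γ hγ Z hZ
        refine ⟨ih γ hγ hZ, fun W hW ↦ ?_⟩
        have hle : (σ.conjSubalgebra q).toSubmodule ≤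
            (σ.freemanChain q n ⊔ (σ.conjSubalgebra q).toSubmodule).comap
              (LieModule.toEnd ℂ g g Z) := by
          conv_lhs => rw [hσq]
          refine iSup₂_le ?_
          intro α hα w hw
          rw [Submodule.mem_comap, LieModule.toEnd_apply_apply]
          have hlie := lie_mem_rootSpace_add hZ hw
          rcases hα with rfl | hα
          · rw [add_zero] at hlie
            exact Submodule.mem_sup_left (ih γ hγ hlie)
          by_cases h0 : γ + α ∈ insert 0 (σ.conjDual H hH '' parabolicSet b φ)
          · exact Submodule.mem_sup_right (hσq.ge (rootSpace_le_weightSum h0 hlie))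
          rw [Set.mem_insert_iff, not_or] at h0
          by_cases hR : γ + α ∈ rootSet H
          · exact Submodule.mem_sup_left (ih _ (reflTransGen_rootStep_add hP hPR hP' hPR'
              ⟨hβ, hβ'.2⟩ hext hγ hα ⟨hR, h0.2⟩) hlie)
          · rw [mem_rootSet_iff] at hR
            push Not at hR
            rw [hR h0.1, LieSubmodule.mem_bot] at hlie
            rw [hlie]
            exact zero_mem _
        exact hle hW
    obtain ⟨x, hx, hx0⟩ := exists_ne_zero_of_mem_rootSet hβ'.1
    have hxq := hmem k β .refl hx
    rw [hk] at hxq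
    rcases mem_of_mem_weightSum hx hx0 (hσq.le hxq.2) with h | h
    · exact (mem_rootSet_iff.mp hβ'.1).1 h
    · exact hβ'.2 h
  · intro hcond
    obtain ⟨k, hk⟩ := σ.exists_freemanChain_succ_eq q
    refine ⟨k, le_antisymm ?_ (σ.inf_conjSubalgebra_le_freemanChain q k)⟩
    have hNq : σ.freemanChain q k ≤ q.toSubmodule :=
      antitone_nat_of_succ_le (f := σ.freemanChain q)
        (fun k ↦ σ.freemanChain_succ_le q k) k.zero_le
    refine fun x hx ↦ ⟨hNq hx, ?_⟩
    have hN := le_weightSum_of_lie_mem (H := H) (σ.freemanChain q k)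
      fun h hh y hy ↦ σ.lie_mem_freemanChain q k (hHq hh) (hHσq hh) hy
    set A := {χ : Dual ℂ H | ∃ x ∈ σ.freemanChain q k, x ∈ rootSpace H (χ : H → ℂ) ∧ x ≠ 0}
    suffices hA : A ⊆ insert 0 (σ.conjDual H hH '' parabolicSet b φ) from
      hσq.ge (weightSum_mono hA (hN hx))
    have hAP : A ⊆ insert 0 (parabolicSet b φ) := fun χ ⟨x, hx, hxχ, hx0⟩ ↦
      mem_of_mem_weightSum hxχ hx0 (hq.le (hNq hx))
    by_contra hcon
    obtain ⟨ht, hneg⟩ := exists_addMonoidHom_neg b φ hφ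
    have hfin : (A \ insert 0 (σ.conjDual H hH '' parabolicSet b φ)).Finite :=
      ((Set.finite_range _).subset hPR |>.insert 0).subset (Set.sdiff_subset.trans hAP)
    -- A weight of the stationary term outside `σ(q)`, of least height.
    obtain ⟨χ, ⟨hχA, hχ⟩, hmin⟩ := Set.exists_min_image _ ht hfin (Set.sdiff_nonempty.mpr hcon)
    rw [Set.mem_insert_iff, not_or] at hχ
    have hχP := (hAP hχA).resolve_left hχ.1
    obtain ⟨α, ⟨hα, hαneg⟩, hsum⟩ := hcond χ
      ⟨hχP, (σ.mem_image_parabolicSetNeg_iff hH).mpr ⟨hPR hχP, hχ.2⟩⟩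
    rw [σ.mem_image_parabolicSetNeg_iff] at hsum
    obtain ⟨Z, hZ, hZχ, hZ0⟩ := hχA
    obtain ⟨W, hWα, hW0⟩ := exists_ne_zero_of_mem_rootSet (hPR' hα)
    have hW : W ∈ σ.conjSubalgebra q :=
      hσq.ge (rootSpace_le_weightSum (Set.mem_insert_of_mem _ hα) hWα)
    have hlie := (hk.ge hZ).2 W hW
    have hle : σ.freemanChain q k ⊔ (σ.conjSubalgebra q).toSubmodule ≤
        weightSum (A ∪ insert 0 (σ.conjDual H hH '' parabolicSet b φ)) :=
      sup_le (hN.trans (weightSum_mono Set.subset_union_left))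
        (hσq.le.trans (weightSum_mono Set.subset_union_right))
    have hnot : χ + α ∉ insert 0 (σ.conjDual H hH '' parabolicSet b φ) := by
      rw [Set.mem_insert_iff, not_or]
      exact ⟨(mem_rootSet_iff.mp hsum.1).1, hsum.2⟩
    have hA := (mem_of_mem_weightSum (lie_mem_rootSpace_add hZχ hWα)
      (lie_ne_zero_of_add_mem_rootSet (hPR hχP) (hPR' hα) hsum.1 hZχ hZ0 hWα hW0)
      (hle hlie)).resolve_right hnot
    have h1 := hmin _ ⟨hA, hnot⟩
    have h2 := hneg α hαneg
    rw [map_add] at h1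
    linarith
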